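/- There is an absolute constant $C\ge 0$ such that the following holds. Let $n\ge 2$, $k\ge 1$ be integers, $\delta\in(0,1)$, $\sigma>0$, $\eta>0$, and set $$\rho=\frac{\sqrt{k}\,\sigma\bigl(1+\sqrt{\log n/k}\bigr)}{\eta},\qquad h(t)=\sqrt{\frac{1}{n-1}\Bigl(k\log\Bigl(1+t\bigl(1+\sqrt{\log n/k}\bigr)^2\Bigr)+4\log\frac{n}{\delta}+C\Bigr)}\quad(t\ge 0).$$ Then $h$ is strictly increasing and positive on $[0,\infty)$. Let $f(\cdot\,;w):X\to Y$ be a model with weight vector $w\in\mathbb{R}^k$, let $l:Y\times Y\to[0,1]$ be a loss function such that $(w,x,y)\mapsto l(y,f(x;w))$ is measurable, let $D$ be a probability distribution on $X\times Y$, and let $S=((x_1,y_1),\dots,(x_n,y_n))$ be an i.i.d. sample from $D$. Put $$L_S(w)=\frac1n\sum_{i=1}^n l(y_i,f(x_i;w)),\qquad L_D(w)=\mathbb{E}_{(x,y)\sim D}\bigl[l(y,f(x;w))\bigr].$$ Let $\{T_w\}_{w\in\mathbb{R}^k}$ be any family of invertible linear operators on $\mathbb{R}^k$. Then, with probability at least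 $1-\delta$ over the choice of $S$, every $w\in\mathbb{R}^k$ for which $\|T_w^{-1}\|_2\le 1/\eta$ (operator norm) and $$L_D(w)\le \mathbb{E}_{\epsilon\sim\mathcal N(0,\sigma^2 I_k)}\bigl[L_D(w+\epsilon)\bigr]$$ satisfies $$L_D(w)\le \sup_{\|T_w^{-1}\epsilon\|_2\le\rho}L_S(w+\epsilon)+h\!\left(\frac{\|w\|_2^2}{\eta^2\rho^2}\right).$$ -/

import Mathlib

open MeasureTheory ProbabilityTheory

noncomputable section

namespace ASAM

/-- The weight space `ℝ^k` with the Euclidean norm. -/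
abbrev Weight (k : ℕ) : Type := EuclideanSpace ℝ (Fin k)

/-- The law of `ε = (ε₁, …, ε_k)` with independent coordinates `ε_i ∼ N(0, σ²)`. -/
def gaussianNoise (k : ℕ) (σ : ℝ) : Measure (Weight k) :=
  (Measure.pi fun _ : Fin k => gaussianReal 0 (σ ^ 2).toNNReal).map (WithLp.toLp 2)

/-- The training loss `L_S(w) = (1/n) ∑ᵢ l(yᵢ, f(xᵢ; w))`. -/
def trainLoss {X Y : Type*} {k n : ℕ} (l : Y → Y → ℝ) (f : Weight k → X → Y)
    (S : Fin n → X × Y) (w : Weight k) : ℝ :=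
  (∑ i, l (S i).2 (f w (S i).1)) / n

/-- The expected loss `L_D(w) = E_{(x,y) ∼ D} [l(y, f(x; w))]`. -/
def expectedLoss {X Y : Type*} [MeasurableSpace X] [MeasurableSpace Y] {k : ℕ}
    (l : Y → Y → ℝ) (f : Weight k → X → Y) (D : Measure (X × Y)) (w : Weight k) : ℝ :=
  ∫ z, l z.2 (f w z.1) ∂D

/-- The maximization region `{ε | ‖T⁻¹ ε‖₂ ≤ ρ}`. -/
def ellipsoid {k : ℕ} (T : Weight k ≃L[ℝ] Weight k) (ρ : ℝ) : Set (Weight k) :=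
  {ε | ‖T.symm ε‖ ≤ ρ}

/-- The largest training loss over `w + ε` with `ε` in the ellipsoid `‖T⁻¹ ε‖₂ ≤ ρ`
(a supremum, which is the maximum whenever that is attained). -/
def worstTrainLoss {X Y : Type*} {k n : ℕ} (l : Y → Y → ℝ) (f : Weight k → X → Y)
    (S : Fin n → X × Y) (T : Weight k ≃L[ℝ] Weight k) (ρ : ℝ) (w : Weight k) : ℝ :=
  sSup ((fun ε => trainLoss l f S (w + ε)) '' ellipsoid T ρ)

/-- The radius `ρ = √k σ (1 + √(log n / k)) / η`. -/
def radius (n k : ℕ) (σ η : ℝ) : ℝ :=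
  √(k : ℝ) * σ * (1 + √(Real.log n / k)) / η

/-- The complexity term `h`, as a function of `t = ‖w‖² / (η² ρ²)`:
`h(t) = √((k log(1 + t (1 + √(log n / k))²) + 4 log(n/δ) + C) / (n - 1))`. -/
def complexityTerm (C : ℝ) (n k : ℕ) (δ t : ℝ) : ℝ :=
  √((k * Real.log (1 + t * (1 + √(Real.log n / k)) ^ 2) + 4 * Real.log (n / δ) + C)
    / ((n : ℝ) - 1))

end ASAM

end

/-! This is a PAC-Bayes argument with posterior `N(w, σ² I)` and a finite grid of priors `N(0, s_j²
I)`, `s_j = σ exp (j / (2k))`, `j < n`. For a fixed prior, Hoeffding, Tonelli and Markov show that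
the prior average of `exp (c (L_D - L_S))` is below `(n/δ) exp (c²/(8n))` except with probability
`δ/n`; a union bound over the grid costs `δ`. Outside these events everything is deterministic, so
`w` and `T_w` may be arbitrary.

Donsker–Varadhan moves this bound to the posterior at the price of the divergence, which is at most
`j/2` once `j ≥ q = k log (1 + ‖w‖²/(kσ²))`. Take `j = ⌈q⌉`. If `q ≥ n - 1` the complexity term
already exceeds `1` and there is nothing to prove, so `n` priors suffice.

Finally the Gaussian average of `L_S` is compared with the supremum: the ball of radius `σ(√k +
√(log n)) = ηρ` lies in the ellipsoid, and the mass outside it is at most `n^(-1/2)`, small enough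
to be absorbed into the constant `C`. -/

namespace ASAM

/-! ### Gaussian densities and change of measure -/

/-- A product of measures with integrable densities has the product density. -/
theorem pi_withDensity_ofReal {ι E : Type*} [Fintype ι] [MeasurableSpace E] (μ : ι → Measure E)
    [∀ i, SigmaFinite (μ i)] (f : ι → E → ℝ) (hf : ∀ i, Integrable (f i) (μ i))
    (h0 : ∀ i x, 0 ≤ f i x) :
    Measure.pi (fun i => (μ i).withDensity fun x => ENNReal.ofReal (f i x)) =
      (Measure.pi μ).withDensity fun x => ENNReal.ofReal (∏ i, f i (x i)) := by
  -- Integrability makes each factor finite, which supplies the σ-finiteness needed to characterize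
  -- the product by its values on boxes.
  have : ∀ i, IsFiniteMeasure ((μ i).withDensity fun x => ENNReal.ofReal (f i x)) :=
    fun i => isFiniteMeasure_withDensity_ofReal (hf i).2
  refine Measure.pi_eq fun s hs => ?_
  have hint : ∀ i, Integrable ((s i).indicator (f i)) (μ i) := fun i => (hf i).indicator (hs i)
  have hnn : ∀ i x, 0 ≤ (s i).indicator (f i) x :=
    fun i x => Set.indicator_nonneg (fun y _ => h0 i y) x
  have hprod : ∀ x : ι → E, (Set.univ.pi s).indicator
      (fun x => ENNReal.ofReal (∏ i, f i (x i))) x =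
        ENNReal.ofReal (∏ i, (s i).indicator (f i) (x i)) := by
    intro x
    by_cases hx : x ∈ Set.univ.pi s
    · rw [Set.indicator_of_mem hx]
      congr 1
      exact Finset.prod_congr rfl fun i _ => (Set.indicator_of_mem (hx i trivial) _).symm
    · rw [Set.indicator_of_notMem hx]
      simp only [Set.mem_univ_pi, not_forall] at hx
      obtain ⟨i, hi⟩ := hx
      rw [Finset.prod_eq_zero (Finset.mem_univ i) (Set.indicator_of_notMem hi _),
        ENNReal.ofReal_zero]
  rw [withDensity_apply _ (MeasurableSet.univ_pi hs),
    ← lintegral_indicator (MeasurableSet.univ_pi hs)]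
  simp_rw [hprod]
  rw [← ofReal_integral_eq_lintegral_ofReal (Integrable.fintype_prod_dep hint)
    (ae_of_all _ fun x => Finset.prod_nonneg fun i _ => hnn i (x i)),
    integral_fintype_prod_eq_prod, ENNReal.ofReal_prod_of_nonneg fun i _ => integral_nonneg (hnn i)]
  refine Finset.prod_congr rfl fun i _ => ?_
  rw [withDensity_apply _ (hs i), ← lintegral_indicator (hs i),
    ofReal_integral_eq_lintegral_ofReal (hint i) (ae_of_all _ (hnn i))]
  refine lintegral_congr fun x => ?_
  by_cases hx : x ∈ s i <;> simp [hx]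

instance (k : ℕ) (σ : ℝ) : IsProbabilityMeasure (gaussianNoise k σ) :=
  Measure.isProbabilityMeasure_map (WithLp.measurable_toLp 2 _).aemeasurable

/-- The Lebesgue density of `gaussianNoise k σ`. -/
noncomputable def noiseDensity (k : ℕ) (σ : ℝ) (x : Weight k) : ℝ :=
  (√(2 * Real.pi * σ ^ 2))⁻¹ ^ k * Real.exp (-‖x‖ ^ 2 / (2 * σ ^ 2))

theorem noiseDensity_pos (k : ℕ) {σ : ℝ} (hσ : 0 < σ) (x : Weight k) : 0 < noiseDensity k σ x := by
  unfold noiseDensity; positivity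

@[fun_prop]
theorem measurable_noiseDensity (k : ℕ) (σ : ℝ) : Measurable (noiseDensity k σ) := by
  unfold noiseDensity; fun_prop

theorem gaussianNoise_eq_withDensity (k : ℕ) {σ : ℝ} (hσ : 0 < σ) :
    gaussianNoise k σ = volume.withDensity fun x => ENNReal.ofReal (noiseDensity k σ x) := by
  have hv : (σ ^ 2).toNNReal ≠ 0 := by simpa using hσ.ne'
  have hc : ((σ ^ 2).toNNReal : ℝ) = σ ^ 2 := Real.coe_toNNReal _ (sq_nonneg σ)
  have hpi : (Measure.pi fun _ : Fin k => gaussianReal 0 (σ ^ 2).toNNReal) =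
      (volume : Measure (Fin k → ℝ)).withDensity
        fun x => ENNReal.ofReal (noiseDensity k σ (WithLp.toLp 2 x)) := by
    simp_rw [gaussianReal_of_var_ne_zero 0 hv]
    unfold gaussianPDF
    rw [pi_withDensity_ofReal (fun _ => volume) (fun _ => gaussianPDFReal 0 (σ ^ 2).toNNReal)
      (fun _ => integrable_gaussianPDFReal _ _) (fun _ => gaussianPDFReal_nonneg _ _), volume_pi]
    congr 1
    ext x
    simp only [gaussianPDFReal, noiseDensity, hc, Finset.prod_mul_distrib, Finset.prod_const,
      Finset.card_univ, Fintype.card_fin, ← Real.exp_sum, sub_zero, EuclideanSpace.norm_sq_eq,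
      Real.norm_eq_abs, sq_abs, ← Finset.sum_div, Finset.sum_neg_distrib]
  ext s hs
  rw [gaussianNoise, Measure.map_apply (WithLp.measurable_toLp 2 _) hs, hpi,
    withDensity_apply _ (WithLp.measurable_toLp 2 _ hs), withDensity_apply _ hs,
    ← (PiLp.volume_preserving_toLp (Fin k)).setLIntegral_comp_preimage hs (by fun_prop)]

/-- Change of measure from a centred Gaussian of scale `s` to one of scale `σ` centred at `w`. -/
theorem lintegral_gaussianNoise_change (k : ℕ) {σ s : ℝ} (hσ : 0 < σ) (hs : 0 < s) (w : Weight k)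
    {F : Weight k → ENNReal} (hF : Measurable F) :
    ∫⁻ x, F x ∂gaussianNoise k s =
      ∫⁻ ε, F (w + ε) * ENNReal.ofReal ((σ / s) ^ k *
        Real.exp (‖ε‖ ^ 2 / (2 * σ ^ 2) - ‖w + ε‖ ^ 2 / (2 * s ^ 2))) ∂gaussianNoise k σ := by
  rw [gaussianNoise_eq_withDensity k hs, gaussianNoise_eq_withDensity k hσ,
    lintegral_withDensity_eq_lintegral_mul _ (by fun_prop) hF,
    lintegral_withDensity_eq_lintegral_mul _ (by fun_prop) (by fun_prop),
    ← lintegral_add_left_eq_self _ w]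
  refine lintegral_congr fun ε => ?_
  simp only [Pi.mul_apply]
  rw [mul_left_comm, ← ENNReal.ofReal_mul (noiseDensity_pos k hσ ε).le, mul_comm]
  congr 2
  unfold noiseDensity
  have hroot : ∀ r : ℝ, 0 < r → √(2 * Real.pi * r ^ 2) = √(2 * Real.pi) * r := fun r hr => by
    rw [Real.sqrt_mul (by positivity), Real.sqrt_sq hr.le]
  rw [hroot s hs, hroot σ hσ, mul_mul_mul_comm, ← mul_pow, ← Real.exp_add]
  have hpi : (0 : ℝ) < √(2 * Real.pi) := by positivity
  congr 2
  · field_simp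
  · ring

/-! ### Gaussian tail and second moments -/

/-- Gaussian concentration of the norm: `‖ε‖ > σ (√k + u)` has probability at most `exp (-u²/2)`. -/
theorem gaussianNoise_norm_gt_le {k : ℕ} (hk : 1 ≤ k) {σ u : ℝ} (hσ : 0 < σ) (hu : 0 ≤ u) :
    gaussianNoise k σ {ε | σ * (√(k : ℝ) + u) < ‖ε‖} ≤ ENNReal.ofReal (Real.exp (-u ^ 2 / 2)) := by
  have hk0 : (0 : ℝ) < k := by exact_mod_cast hk
  have hsk : 0 < √(k : ℝ) := Real.sqrt_pos.2 hk0
  have hksq : √(k : ℝ) ^ 2 = k := Real.sq_sqrt hk0.le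
  -- Compare with the Gaussian of scale `rσ`: on `B` the likelihood ratio is at most `r^k exp (-k(r²
  -- - 1)/2)`, and `log r ≤ r - 1` bounds this by `exp (-k(r - 1)²/2) = exp (-u²/2)`.
  set r : ℝ := 1 + u / √(k : ℝ) with hr
  have hr1 : 1 ≤ r := le_add_of_nonneg_right (by positivity)
  have hr0 : 0 < r := by linarith
  have hur : u = √(k : ℝ) * (r - 1) := by rw [hr]; field_simp; ring
  set B : Set (Weight k) := {ε | σ * (√(k : ℝ) + u) < ‖ε‖}
  have hB : MeasurableSet B := measurableSet_lt measurable_const measurable_norm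
  have hexp : ∀ x ∈ B, (r * σ / σ) ^ k * Real.exp (‖x‖ ^ 2 / (2 * (r * σ) ^ 2) -
      ‖(0 : Weight k) + x‖ ^ 2 / (2 * σ ^ 2)) ≤ Real.exp (-u ^ 2 / 2) := by
    intro x hx
    have hx' : σ * (√(k : ℝ) * r) ≤ ‖x‖ := by
      have : σ * (√(k : ℝ) + u) < ‖x‖ := hx
      rw [hur] at this
      linarith
    have hx2 : σ ^ 2 * (k * r ^ 2) ≤ ‖x‖ ^ 2 := by
      have := pow_le_pow_left₀ (by positivity) hx' 2
      rwa [mul_pow, mul_pow, hksq] at this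
    have hpow : (r * σ / σ) ^ k = Real.exp (k * Real.log r) := by
      rw [mul_div_cancel_right₀ _ hσ.ne', mul_comm, ← Real.rpow_def_of_pos hr0, Real.rpow_natCast]
    rw [hpow, ← Real.exp_add, zero_add]
    apply Real.exp_le_exp.2
    have hlog : Real.log r ≤ r - 1 := Real.log_le_sub_one_of_pos hr0
    have hq : ‖x‖ ^ 2 / (2 * (r * σ) ^ 2) - ‖x‖ ^ 2 / (2 * σ ^ 2) =
        -(‖x‖ ^ 2 / (σ ^ 2 * r ^ 2) * (r ^ 2 - 1) / 2) := by
      field_simp; ring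
    have hq2 : (k : ℝ) ≤ ‖x‖ ^ 2 / (σ ^ 2 * r ^ 2) := by
      rw [le_div_iff₀ (by positivity)]; linarith
    have hr2 : 0 ≤ r ^ 2 - 1 := by nlinarith
    rw [hq, hur, mul_pow, hksq]
    nlinarith [mul_le_mul_of_nonneg_right hq2 hr2, mul_le_mul_of_nonneg_left hlog hk0.le]
  calc gaussianNoise k σ B = ∫⁻ x, B.indicator 1 x ∂gaussianNoise k σ :=
        (lintegral_indicator_one hB).symm
    _ = ∫⁻ x, B.indicator 1 ((0 : Weight k) + x) * ENNReal.ofReal ((r * σ / σ) ^ k *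
        Real.exp (‖x‖ ^ 2 / (2 * (r * σ) ^ 2) - ‖(0 : Weight k) + x‖ ^ 2 / (2 * σ ^ 2)))
          ∂gaussianNoise k (r * σ) :=
        lintegral_gaussianNoise_change k (by positivity) hσ 0 (measurable_one.indicator hB)
    _ ≤ ∫⁻ _, ENNReal.ofReal (Real.exp (-u ^ 2 / 2)) ∂gaussianNoise k (r * σ) := by
        refine lintegral_mono fun x => ?_
        by_cases hx : x ∈ B
        · simpa [hx] using ENNReal.ofReal_le_ofReal (by simpa using hexp x hx)
        · simp [hx]
    _ = ENNReal.ofReal (Real.exp (-u ^ 2 / 2)) := by simp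

theorem memLp_coord_gaussianNoise (k : ℕ) (σ : ℝ) (i : Fin k) :
    MemLp (fun ε : Weight k => ε i) 2 (gaussianNoise k σ) := by
  unfold gaussianNoise
  rw [memLp_map_measure_iff (by fun_prop) (by fun_prop)]
  exact (memLp_id_gaussianReal' 2 (by simp)).comp_measurePreserving
    (measurePreserving_eval (fun _ : Fin k => gaussianReal 0 (σ ^ 2).toNNReal) i)

theorem integral_coord_gaussianNoise (k : ℕ) (σ : ℝ) (i : Fin k) :
    ∫ ε : Weight k, ε i ∂gaussianNoise k σ = 0 := by
  unfold gaussianNoise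
  rw [integral_map (by fun_prop) (by fun_prop)]
  exact integral_eval.trans integral_id_gaussianReal

theorem integral_coord_sq_gaussianNoise (k : ℕ) (σ : ℝ) (i : Fin k) :
    ∫ ε : Weight k, ε i ^ 2 ∂gaussianNoise k σ = σ ^ 2 := by
  unfold gaussianNoise
  rw [integral_map (by fun_prop) (by fun_prop)]
  have h := variance_fun_id_gaussianReal (μ := 0) (v := (σ ^ 2).toNNReal)
  rw [variance_of_integral_eq_zero (by fun_prop) (by simp)] at h
  rw [Real.coe_toNNReal _ (sq_nonneg σ)] at h
  refine Eq.trans ?_ h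
  exact integral_comp_eval (μ := fun _ : Fin k => gaussianReal 0 (σ ^ 2).toNNReal) (i := i)
    (f := fun x : ℝ => x ^ 2) (by fun_prop)

theorem integrable_norm_add_sq_gaussianNoise (k : ℕ) (σ : ℝ) (w : Weight k) :
    Integrable (fun ε => ‖w + ε‖ ^ 2) (gaussianNoise k σ) := by
  simp only [EuclideanSpace.norm_sq_eq, Real.norm_eq_abs, sq_abs, PiLp.add_apply]
  exact integrable_finsetSum _ fun i _ =>
    ((memLp_const (w i)).add (memLp_coord_gaussianNoise k σ i)).integrable_sq

theorem integral_norm_add_sq_gaussianNoise (k : ℕ) (σ : ℝ) (w : Weight k) :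
    ∫ ε, ‖w + ε‖ ^ 2 ∂gaussianNoise k σ = ‖w‖ ^ 2 + k * σ ^ 2 := by
  have hm := memLp_coord_gaussianNoise k σ
  simp only [EuclideanSpace.norm_sq_eq, Real.norm_eq_abs, sq_abs, PiLp.add_apply]
  have hint : ∀ i, Integrable (fun ε : Weight k => (w i + ε i) ^ 2) (gaussianNoise k σ) :=
    fun i => ((memLp_const (w i)).add (hm i)).integrable_sq
  rw [integral_finsetSum _ fun i _ => hint i]
  have hcoord : ∀ i, ∫ ε : Weight k, (w i + ε i) ^ 2 ∂gaussianNoise k σ = w i ^ 2 + σ ^ 2 := by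
    intro i
    have h1 : Integrable (fun ε : Weight k => 2 * w i * ε i) (gaussianNoise k σ) :=
      ((hm i).integrable (by norm_num)).const_mul _
    simp_rw [add_sq]
    rw [integral_add (by fun_prop) (hm i).integrable_sq, integral_add (by fun_prop) h1,
      integral_const_mul, integral_coord_gaussianNoise, integral_coord_sq_gaussianNoise]
    simp
  simp [hcoord, Finset.sum_add_distrib]

/-! ### Exponential moments: Donsker–Varadhan and Hoeffding -/

/-- The Donsker–Varadhan inequality for Gaussians: the Kullback–Leibler divergence of
`N(w, σ² I)` from `N(0, s² I)` is `k log (s/σ) - k/2 + (‖w‖² + k σ²) / (2 s²)`. -/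
theorem exp_integral_sub_le_lintegral_exp (k : ℕ) {σ s : ℝ} (hσ : 0 < σ) (hs : 0 < s) (w : Weight k)
    {g : Weight k → ℝ} (hg : Measurable g)
    (hint : Integrable (fun ε => g (w + ε)) (gaussianNoise k σ)) :
    ENNReal.ofReal (Real.exp ((∫ ε, g (w + ε) ∂gaussianNoise k σ) -
      (k * Real.log (s / σ) - k / 2 + (‖w‖ ^ 2 + k * σ ^ 2) / (2 * s ^ 2)))) ≤
      ∫⁻ x, ENNReal.ofReal (Real.exp (g x)) ∂gaussianNoise k s := by
  have hsq0 : Integrable (fun ε : Weight k => ‖ε‖ ^ 2) (gaussianNoise k σ) := by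
    simpa using integrable_norm_add_sq_gaussianNoise k σ 0
  have hsq := integrable_norm_add_sq_gaussianNoise k σ w
  have hE0 : ∫ ε, ‖ε‖ ^ 2 ∂gaussianNoise k σ = k * σ ^ 2 := by
    simpa using integral_norm_add_sq_gaussianNoise k σ 0
  have hE := integral_norm_add_sq_gaussianNoise k σ w
  -- `Z` is `g` plus the log-density of the prior relative to the posterior: its mean is the mean of
  -- `g` minus the divergence, and Jensen for `exp` concludes.
  set Z : Weight k → ℝ := fun ε => g (w + ε) - k * Real.log (s / σ) +
    ‖ε‖ ^ 2 / (2 * σ ^ 2) - ‖w + ε‖ ^ 2 / (2 * s ^ 2) with hZ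
  have hint₁ : Integrable (fun ε => g (w + ε) - k * Real.log (s / σ)) (gaussianNoise k σ) :=
    hint.sub (integrable_const _)
  have hint₂ : Integrable (fun ε => g (w + ε) - k * Real.log (s / σ) + ‖ε‖ ^ 2 / (2 * σ ^ 2))
      (gaussianNoise k σ) := hint₁.add (hsq0.div_const _)
  have hZint : Integrable Z (gaussianNoise k σ) := hint₂.sub (hsq.div_const _)
  have hEZ : ∫ ε, Z ε ∂gaussianNoise k σ = (∫ ε, g (w + ε) ∂gaussianNoise k σ) -
      (k * Real.log (s / σ) - k / 2 + (‖w‖ ^ 2 + k * σ ^ 2) / (2 * s ^ 2)) := by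
    rw [hZ, integral_sub hint₂ (hsq.div_const _), integral_add hint₁ (hsq0.div_const _),
      integral_sub hint (integrable_const _), integral_div, integral_div, hE0, hE]
    simp only [integral_const, probReal_univ, one_smul]
    field_simp
    ring
  have hpow : (σ / s) ^ k = Real.exp (-(k * Real.log (s / σ))) := by
    rw [← mul_neg, ← Real.log_inv, inv_div, mul_comm, ← Real.rpow_def_of_pos (by positivity),
      Real.rpow_natCast]
  have hchange : ∫⁻ x, ENNReal.ofReal (Real.exp (g x)) ∂gaussianNoise k s =
      ∫⁻ ε, ENNReal.ofReal (Real.exp (Z ε)) ∂gaussianNoise k σ := by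
    rw [lintegral_gaussianNoise_change k hσ hs w (by fun_prop)]
    refine lintegral_congr fun ε => ?_
    rw [← ENNReal.ofReal_mul (Real.exp_pos _).le, hpow, ← Real.exp_add, ← Real.exp_add]
    congr 2
    simp only [hZ]
    ring
  rw [hchange, ← hEZ]
  have hZm : Measurable Z := by fun_prop
  by_cases htop : ∫⁻ ε, ENNReal.ofReal (Real.exp (Z ε)) ∂gaussianNoise k σ = ⊤
  · simp [htop]
  have hexp : Integrable (fun ε => Real.exp (Z ε)) (gaussianNoise k σ) :=
    (lintegral_ofReal_ne_top_iff_integrable (by fun_prop)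
      (ae_of_all _ fun _ => (Real.exp_pos _).le)).1 htop
  rw [← ofReal_integral_eq_lintegral_ofReal hexp (ae_of_all _ fun _ => (Real.exp_pos _).le)]
  exact ENNReal.ofReal_le_ofReal (convexOn_exp.map_integral_le Real.continuous_exp.continuousOn
    isClosed_univ (ae_of_all _ fun _ => trivial) hZint hexp)

/-- Hoeffding's bound on the exponential moment of the deviation of an empirical mean. -/
theorem lintegral_exp_mean_sub_le {Ω : Type*} [MeasurableSpace Ω] (D : Measure Ω)
    [IsProbabilityMeasure D] {n : ℕ} (hn : 0 < n) {g : Ω → ℝ} (hg : Measurable g)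
    (hg01 : ∀ z, g z ∈ Set.Icc (0 : ℝ) 1) (c : ℝ) :
    ∫⁻ S, ENNReal.ofReal (Real.exp (c * ((∫ z, g z ∂D) - (∑ i, g (S i)) / n)))
      ∂Measure.pi (fun _ : Fin n => D) ≤ ENNReal.ofReal (Real.exp (c ^ 2 / (8 * n))) := by
  have hn0 : (0 : ℝ) < n := by exact_mod_cast hn
  have hsub := hasSubgaussianMGF_of_mem_Icc hg.aemeasurable (ae_of_all D hg01)
  -- A variable in `[0, 1]` has variance proxy `1/4`, so each of the `n` factors contributes `exp
  -- ((c/n)²/8)`.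
  have hmgf := hsub.mgf_le (-(c / n))
  have hint := hsub.integrable_exp_mul (-(c / n))
  unfold mgf at hmgf
  have hprod : ∀ S : Fin n → Ω, Real.exp (c * ((∫ z, g z ∂D) - (∑ i, g (S i)) / n)) =
      ∏ i, Real.exp (-(c / n) * (g (S i) - ∫ z, g z ∂D)) := by
    intro S
    rw [← Real.exp_sum, ← Finset.mul_sum, Finset.sum_sub_distrib]
    simp only [Finset.sum_const, Finset.card_univ, Fintype.card_fin, nsmul_eq_mul]
    congr 1
    field_simp
    ring
  simp_rw [hprod]
  rw [← ofReal_integral_eq_lintegral_ofReal (Integrable.fintype_prod fun _ => hint)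
    (ae_of_all _ fun S => Finset.prod_nonneg fun i _ => (Real.exp_pos _).le),
    integral_fintype_prod_eq_pow (fun z => Real.exp (-(c / n) * (g z - ∫ z, g z ∂D)))]
  apply ENNReal.ofReal_le_ofReal
  refine (pow_le_pow_left₀ (integral_nonneg fun _ => (Real.exp_pos _).le) hmgf _).trans_eq ?_
  rw [← Real.exp_nat_mul, Fintype.card_fin]
  congr 1
  simp only [sub_zero, nnnorm_one, NNReal.coe_pow, NNReal.coe_div, NNReal.coe_one,
    NNReal.coe_ofNat]
  field_simp
  ring

/-! ### PAC-Bayes bound for the losses -/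

section Loss

variable {X Y : Type*} {k n : ℕ} {l : Y → Y → ℝ} {f : Weight k → X → Y}

theorem trainLoss_mem_Icc (hl : ∀ y y' : Y, 0 ≤ l y y' ∧ l y y' ≤ 1) (S : Fin n → X × Y)
    (w : Weight k) : trainLoss l f S w ∈ Set.Icc (0 : ℝ) 1 := by
  unfold trainLoss
  refine ⟨div_nonneg (Finset.sum_nonneg fun i _ => (hl _ _).1) n.cast_nonneg,
    div_le_one_of_le₀ ?_ n.cast_nonneg⟩
  simpa using Finset.sum_le_card_nsmul Finset.univ (fun i => l (S i).2 (f w (S i).1)) 1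
    fun i _ => (hl _ _).2

variable [MeasurableSpace X] [MeasurableSpace Y]

theorem measurable_trainLoss (hm : Measurable fun p : Weight k × X × Y => l p.2.2 (f p.1 p.2.1)) :
    Measurable fun p : Weight k × (Fin n → X × Y) => trainLoss l f p.2 p.1 := by
  unfold trainLoss
  refine Measurable.div_const (Finset.measurable_sum _ fun i _ => ?_) _
  exact hm.comp (measurable_fst.prodMk ((measurable_pi_apply i).comp measurable_snd))

variable (D : Measure (X × Y)) [IsProbabilityMeasure D]

theorem expectedLoss_mem_Icc (hl : ∀ y y' : Y, 0 ≤ l y y' ∧ l y y' ≤ 1)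
    (hm : Measurable fun p : Weight k × X × Y => l p.2.2 (f p.1 p.2.1)) (w : Weight k) :
    expectedLoss l f D w ∈ Set.Icc (0 : ℝ) 1 := by
  have hmw : Measurable fun z : X × Y => l z.2 (f w z.1) := hm.comp measurable_prodMk_left
  refine ⟨integral_nonneg fun z => (hl _ _).1, ?_⟩
  have := integral_mono (μ := D) (Integrable.of_mem_Icc 0 1 hmw.aemeasurable
    (ae_of_all _ fun z => hl _ _)) (integrable_const (1 : ℝ)) fun z => (hl _ _).2
  simpa [expectedLoss] using this

theorem measurable_expectedLoss
    (hm : Measurable fun p : Weight k × X × Y => l p.2.2 (f p.1 p.2.1)) :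
    Measurable (expectedLoss l f D) :=
  (StronglyMeasurable.integral_prod_right hm.stronglyMeasurable).measurable

/-- Markov's inequality for the exponential moment of the generalization gap under a Gaussian
prior of scale `s`. -/
theorem measure_lintegral_exp_gap_ge_le (hn : 0 < n) (hl : ∀ y y' : Y, 0 ≤ l y y' ∧ l y y' ≤ 1)
    (hm : Measurable fun p : Weight k × X × Y => l p.2.2 (f p.1 p.2.1)) (s c : ℝ)
    {a : ℝ} (ha : 0 < a) :
    Measure.pi (fun _ : Fin n => D) {S | ENNReal.ofReal (a * Real.exp (c ^ 2 / (8 * n))) ≤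
      ∫⁻ x, ENNReal.ofReal (Real.exp (c * (expectedLoss l f D x - trainLoss l f S x)))
        ∂gaussianNoise k s} ≤ ENNReal.ofReal a⁻¹ := by
  have hT : Measurable fun p : Weight k × (Fin n → X × Y) => trainLoss l f p.2 p.1 :=
    measurable_trainLoss hm
  have hE := measurable_expectedLoss D hm
  have hφ : Measurable fun p : Weight k × (Fin n → X × Y) =>
      ENNReal.ofReal (Real.exp (c * (expectedLoss l f D p.1 - trainLoss l f p.2 p.1))) := by
    fun_prop
  have hφ' : Measurable fun p : (Fin n → X × Y) × Weight k =>
      ENNReal.ofReal (Real.exp (c * (expectedLoss l f D p.2 - trainLoss l f p.1 p.2))) :=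
    hφ.comp measurable_swap
  have hΦ : Measurable fun S : Fin n → X × Y => ∫⁻ x, ENNReal.ofReal
      (Real.exp (c * (expectedLoss l f D x - trainLoss l f S x))) ∂gaussianNoise k s :=
    hφ'.lintegral_prod_right'
  have hle : ∫⁻ S, ∫⁻ x, ENNReal.ofReal
      (Real.exp (c * (expectedLoss l f D x - trainLoss l f S x))) ∂gaussianNoise k s
        ∂Measure.pi (fun _ : Fin n => D) ≤ ENNReal.ofReal (Real.exp (c ^ 2 / (8 * n))) := by
    -- The swap is possible because the prior does not depend on the sample; Hoeffding then applies
    -- at each fixed weight.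
    rw [lintegral_lintegral_swap hφ'.aemeasurable]
    refine (lintegral_mono fun x => lintegral_exp_mean_sub_le D hn
      (hm.comp measurable_prodMk_left) (fun z => hl _ _) c).trans ?_
    simp
  set e := Real.exp (c ^ 2 / (8 * n)) with he
  have he0 : 0 < e := Real.exp_pos _
  have hmk := (mul_meas_ge_le_lintegral hΦ (ENNReal.ofReal (a * e))).trans hle
  have hinv : a⁻¹ = e / (a * e) := by field_simp
  rw [hinv, ENNReal.ofReal_div_of_pos (by positivity), ENNReal.le_div_iff_mul_le
    (Or.inl (ENNReal.ofReal_pos.2 (by positivity)).ne') (Or.inl ENNReal.ofReal_ne_top), mul_comm]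
  exact hmk

variable {D}

/-- The Kullback–Leibler divergence of `N(w, σ² I)` from the prior of scale `σ exp (j / (2k))` is
at most `j / 2` as soon as that prior is wide enough for `w`. -/
theorem gaussian_divergence_le (hk : 1 ≤ k) {σ : ℝ} (hσ : 0 < σ) {j : ℝ} {w : Weight k}
    (hj : k * Real.log (1 + ‖w‖ ^ 2 / (k * σ ^ 2)) ≤ j) :
    k * Real.log (σ * Real.exp (j / (2 * k)) / σ) - k / 2 +
      (‖w‖ ^ 2 + k * σ ^ 2) / (2 * (σ * Real.exp (j / (2 * k))) ^ 2) ≤ j / 2 := by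
  have hk0 : (0 : ℝ) < k := by exact_mod_cast hk
  have hsq : Real.exp (j / (2 * k)) ^ 2 = Real.exp (j / k) := by
    rw [← Real.exp_nat_mul]; congr 1; push_cast; field_simp
  rw [mul_div_cancel_left₀ _ hσ.ne', Real.log_exp, mul_pow, hsq]
  -- The prior variance is at least `σ² + ‖w‖²/k`, so the quadratic term is at most `k/2` and
  -- cancels the `-k/2`.
  have h1 : 1 + ‖w‖ ^ 2 / (k * σ ^ 2) ≤ Real.exp (j / k) := by
    rw [← Real.log_le_iff_le_exp (by positivity), le_div_iff₀ hk0]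
    linarith
  have h2 : (‖w‖ ^ 2 + k * σ ^ 2) / (2 * (σ ^ 2 * Real.exp (j / k))) ≤ k / 2 := by
    rw [div_le_iff₀ (by positivity)]
    have := mul_le_mul_of_nonneg_left h1 (by positivity : (0 : ℝ) ≤ k * σ ^ 2)
    rw [mul_add, mul_one, mul_div_cancel₀ _ (by positivity)] at this
    linarith
  have h3 : (k : ℝ) * (j / (2 * k)) = j / 2 := by field_simp
  linarith

theorem integrable_trainLoss_add (hl : ∀ y y' : Y, 0 ≤ l y y' ∧ l y y' ≤ 1)
    (hm : Measurable fun p : Weight k × X × Y => l p.2.2 (f p.1 p.2.1)) (S : Fin n → X × Y)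
    (w : Weight k) (σ : ℝ) :
    Integrable (fun ε => trainLoss l f S (w + ε)) (gaussianNoise k σ) := by
  have hT : Measurable (trainLoss l f S) := (measurable_trainLoss hm).comp measurable_prodMk_right
  exact Integrable.of_mem_Icc 0 1 (by fun_prop) (ae_of_all _ fun ε => trainLoss_mem_Icc hl S _)

/-- The PAC-Bayes bound for Gaussian perturbations, on the event that the exponential moment of
the gap under the `j`-th prior is small. -/
theorem integral_expectedLoss_le (hn : 0 < n) (hk : 1 ≤ k)
    (hl : ∀ y y' : Y, 0 ≤ l y y' ∧ l y y' ≤ 1)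
    (hm : Measurable fun p : Weight k × X × Y => l p.2.2 (f p.1 p.2.1)) {σ : ℝ} (hσ : 0 < σ)
    {j a : ℝ} (hj0 : 0 ≤ j) (ha : 1 < a) {w : Weight k}
    (hj : k * Real.log (1 + ‖w‖ ^ 2 / (k * σ ^ 2)) ≤ j) {S : Fin n → X × Y}
    (hS : ∫⁻ x, ENNReal.ofReal (Real.exp (√(8 * n * (j / 2 + Real.log a)) *
        (expectedLoss l f D x - trainLoss l f S x))) ∂gaussianNoise k (σ * Real.exp (j / (2 * k))) <
      ENNReal.ofReal (a * Real.exp (√(8 * n * (j / 2 + Real.log a)) ^ 2 / (8 * n)))) :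
    ∫ ε, expectedLoss l f D (w + ε) ∂gaussianNoise k σ ≤
      (∫ ε, trainLoss l f S (w + ε) ∂gaussianNoise k σ) + √((j / 2 + Real.log a) / (2 * n)) := by
  have hn0 : (0 : ℝ) < n := by exact_mod_cast hn
  have ha0 : 0 < a := by linarith
  set A := j / 2 + Real.log a with hA
  have hA0 : 0 < A := by have := Real.log_pos ha; positivity
  -- This `c` minimizes `(A + c²/(8n)) / c`. It depends on `j` but not on `w`, so the event in `hS`
  -- serves all `w` at level `j`.
  set c := √(8 * n * A) with hc
  have hc0 : 0 < c := Real.sqrt_pos.2 (by positivity)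
  have hc2 : c ^ 2 = 8 * n * A := Real.sq_sqrt (by positivity)
  have hEm := measurable_expectedLoss D hm
  have hTm : Measurable (trainLoss l f S) := (measurable_trainLoss hm).comp measurable_prodMk_right
  have hTi := integrable_trainLoss_add hl hm S w σ
  have hEi : Integrable (fun ε => expectedLoss l f D (w + ε)) (gaussianNoise k σ) :=
    Integrable.of_mem_Icc 0 1 (by fun_prop) (ae_of_all _ fun ε => expectedLoss_mem_Icc D hl hm _)
  have hDV := (exp_integral_sub_le_lintegral_exp k hσ (s := σ * Real.exp (j / (2 * k)))
    (by positivity) w (g := fun x => c * (expectedLoss l f D x - trainLoss l f S x))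
    (by fun_prop) ((hEi.sub hTi).const_mul c)).trans_lt hS
  have haexp : a * Real.exp (c ^ 2 / (8 * n)) = Real.exp (Real.log a + A) := by
    rw [Real.exp_add, Real.exp_log ha0, hc2, mul_div_cancel_left₀ _ (by positivity)]
  rw [haexp, ENNReal.ofReal_lt_ofReal_iff (Real.exp_pos _), Real.exp_lt_exp, integral_const_mul,
    integral_sub hEi hTi] at hDV
  have hkl := gaussian_divergence_le hk hσ hj
  have hgap : (∫ ε, expectedLoss l f D (w + ε) ∂gaussianNoise k σ) -
      (∫ ε, trainLoss l f S (w + ε) ∂gaussianNoise k σ) ≤ 2 * A / c := by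
    rw [le_div_iff₀ hc0, mul_comm]
    linarith
  have hroot : 2 * A / c = √(A / (2 * n)) := by
    symm
    rw [Real.sqrt_eq_iff_mul_self_eq (by positivity) (by positivity), ← sq, div_pow, hc2]
    field_simp
    norm_num
  linarith

/-- The averaged training loss is at most the worst training loss over an ellipsoid containing a
ball, up to the Gaussian mass outside that ball. -/
theorem integral_trainLoss_le_worstTrainLoss (hk : 1 ≤ k)
    (hl : ∀ y y' : Y, 0 ≤ l y y' ∧ l y y' ≤ 1)
    (hm : Measurable fun p : Weight k × X × Y => l p.2.2 (f p.1 p.2.1)) {σ u ρ : ℝ} (hσ : 0 < σ)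
    (hu : 0 ≤ u) (S : Fin n → X × Y) (w : Weight k) (T : Weight k ≃L[ℝ] Weight k)
    (hT : ∀ ε : Weight k, ‖ε‖ ≤ σ * (√(k : ℝ) + u) → ε ∈ ellipsoid T ρ) :
    ∫ ε, trainLoss l f S (w + ε) ∂gaussianNoise k σ ≤
      worstTrainLoss l f S T ρ w + Real.exp (-u ^ 2 / 2) := by
  set B : Set (Weight k) := {ε | σ * (√(k : ℝ) + u) < ‖ε‖}
  have hB : MeasurableSet B := measurableSet_lt measurable_const measurable_norm
  have hbdd : BddAbove ((fun ε => trainLoss l f S (w + ε)) '' ellipsoid T ρ) :=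
    ⟨1, by rintro _ ⟨ε, -, rfl⟩; exact (trainLoss_mem_Icc hl S _).2⟩
  have hball : ∀ ε, ε ∉ B → trainLoss l f S (w + ε) ≤ worstTrainLoss l f S T ρ w :=
    fun ε hε => le_csSup hbdd ⟨ε, hT ε (not_lt.1 hε), rfl⟩
  -- Needed on `B`, where the loss is only known to be at most `1`; `ε = 0` lies in the ball, hence
  -- in the ellipsoid.
  have h0 : 0 ≤ worstTrainLoss l f S T ρ w := by
    refine (trainLoss_mem_Icc hl S _).1.trans (hball 0 ?_)
    simp only [B, Set.mem_ofPred_eq, norm_zero, not_lt]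
    positivity
  have hind : Integrable (B.indicator (1 : Weight k → ℝ)) (gaussianNoise k σ) :=
    (integrable_const (1 : ℝ)).indicator hB
  calc ∫ ε, trainLoss l f S (w + ε) ∂gaussianNoise k σ
      ≤ ∫ ε, worstTrainLoss l f S T ρ w + B.indicator 1 ε ∂gaussianNoise k σ := by
        refine integral_mono (integrable_trainLoss_add hl hm S w σ)
          ((integrable_const _).add hind) fun ε => ?_
        by_cases hε : ε ∈ B
        · simpa [hε] using (trainLoss_mem_Icc hl S (w + ε)).2.trans (le_add_of_nonneg_left h0)
        · simpa [hε] using hball ε hε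
    _ = worstTrainLoss l f S T ρ w + (gaussianNoise k σ).real B := by
        rw [integral_add (integrable_const _) hind, integral_indicator_one hB]
        simp
    _ ≤ _ := by
        gcongr
        exact ENNReal.toReal_le_of_le_ofReal (Real.exp_pos _).le (gaussianNoise_norm_gt_le hk hσ hu)

end Loss

theorem worstTrainLoss_nonneg {X Y : Type*} {k n : ℕ} {l : Y → Y → ℝ} {f : Weight k → X → Y}
    (hl : ∀ y y' : Y, 0 ≤ l y y' ∧ l y y' ≤ 1) (S : Fin n → X × Y) (T : Weight k ≃L[ℝ] Weight k)
    (ρ : ℝ) (w : Weight k) : 0 ≤ worstTrainLoss l f S T ρ w := by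
  refine Real.sSup_nonneg ?_
  rintro _ ⟨ε, -, rfl⟩
  exact (trainLoss_mem_Icc hl S _).1

/-! ### Complexity term and radius -/

theorem log_natCast_div_pos {n : ℕ} {δ : ℝ} (hn : 2 ≤ n) (hδ : 0 < δ) (hδ1 : δ < 1) :
    0 < Real.log (n / δ) := by
  have hn2 : (2 : ℝ) ≤ n := by exact_mod_cast hn
  exact Real.log_pos ((one_lt_div hδ).2 (by linarith))

theorem strictMonoOn_complexityTerm {C : ℝ} (hC : 0 ≤ C) {n k : ℕ} {δ : ℝ} (hn : 2 ≤ n)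
    (hk : 1 ≤ k) (hδ : 0 < δ) (hδ1 : δ < 1) :
    StrictMonoOn (complexityTerm C n k δ) (Set.Ici 0) := by
  intro s hs t _ hst
  have hs : 0 ≤ s := hs
  have hn2 : (2 : ℝ) ≤ n := by exact_mod_cast hn
  have hn1 : (0 : ℝ) < n - 1 := by linarith
  have hk0 : (0 : ℝ) < k := by exact_mod_cast hk
  have hL := log_natCast_div_pos hn hδ hδ1
  have hb : 0 < (1 + √(Real.log n / k)) ^ 2 := by positivity
  have hlog0 : 0 ≤ Real.log (1 + s * (1 + √(Real.log n / k)) ^ 2) :=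
    Real.log_nonneg (le_add_of_nonneg_right (by positivity))
  unfold complexityTerm
  refine Real.sqrt_lt_sqrt (by positivity) ?_
  gcongr

theorem complexityTerm_pos {C : ℝ} (hC : 0 ≤ C) {n k : ℕ} {δ t : ℝ} (hn : 2 ≤ n)
    (hδ : 0 < δ) (hδ1 : δ < 1) (ht : 0 ≤ t) : 0 < complexityTerm C n k δ t := by
  have hn2 : (2 : ℝ) ≤ n := by exact_mod_cast hn
  have hn1 : (0 : ℝ) < n - 1 := by linarith
  have hL := log_natCast_div_pos hn hδ hδ1
  have hlog0 : 0 ≤ Real.log (1 + t * (1 + √(Real.log n / k)) ^ 2) :=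
    Real.log_nonneg (le_add_of_nonneg_right (by positivity))
  exact Real.sqrt_pos.2 (by positivity)

theorem mul_radius {n k : ℕ} (hk : 1 ≤ k) (σ : ℝ) {η : ℝ} (hη : 0 < η) :
    η * radius n k σ η = σ * (√(k : ℝ) + √(Real.log n)) := by
  have hsk : 0 < √(k : ℝ) := Real.sqrt_pos.2 (by exact_mod_cast hk)
  rw [radius, Real.sqrt_div' _ k.cast_nonneg]
  field_simp

/-- The factor `(1 + √(log n / k))²` in `h` cancels the one in `ρ²`, leaving exactly the quantity
that controls the divergence. -/
theorem complexityTerm_eq (C : ℝ) {n k : ℕ} (hk : 1 ≤ k) (δ : ℝ) {σ η : ℝ} (hσ : 0 < σ)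
    (hη : 0 < η) (w : Weight k) :
    complexityTerm C n k δ (‖w‖ ^ 2 / (η ^ 2 * radius n k σ η ^ 2)) =
      √((k * Real.log (1 + ‖w‖ ^ 2 / (k * σ ^ 2)) + 4 * Real.log (n / δ) + C) / ((n : ℝ) - 1)) := by
  have hk0 : (0 : ℝ) < k := by exact_mod_cast hk
  have hb : 0 < 1 + √(Real.log n / k) := by positivity
  have hsq : η ^ 2 * radius n k σ η ^ 2 = k * σ ^ 2 * (1 + √(Real.log n / k)) ^ 2 := by
    rw [radius, div_pow, mul_pow, mul_pow, Real.sq_sqrt hk0.le]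
    field_simp
  rw [complexityTerm, hsq, ← div_div, div_mul_cancel₀ _ (by positivity)]

theorem ball_subset_ellipsoid {n k : ℕ} (hk : 1 ≤ k) {σ η : ℝ} (hη : 0 < η)
    {T : Weight k ≃L[ℝ] Weight k} (hT : ‖(T.symm : Weight k →L[ℝ] Weight k)‖ ≤ 1 / η)
    (ε : Weight k) (hε : ‖ε‖ ≤ σ * (√(k : ℝ) + √(Real.log n))) :
    ε ∈ ellipsoid T (radius n k σ η) := by
  have h := (T.symm : Weight k →L[ℝ] Weight k).le_of_opNorm_le hT ε
  refine h.trans ?_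
  rw [one_div, inv_mul_le_iff₀ hη, mul_radius hk σ hη]
  exact hε

/-- The PAC-Bayes deviation and the Gaussian tail are absorbed by the complexity term. -/
theorem sqrt_add_exp_le_sqrt {n : ℕ} (hn : 2 ≤ n) {q j L : ℝ} (hq : 0 ≤ q) (hj0 : 0 ≤ j)
    (hj : j ≤ q + 1) (hL : 0 ≤ L) :
    √((j / 2 + L) / (2 * n)) + Real.exp (-√(Real.log n) ^ 2 / 2) ≤
      √((q + 4 * L + 5 / 2) / ((n : ℝ) - 1)) := by
  have hn2 : (2 : ℝ) ≤ n := by exact_mod_cast hn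
  have hn1 : (0 : ℝ) < n - 1 := by linarith
  have hn0 : (0 : ℝ) < n := by linarith
  apply Real.le_sqrt_of_sq_le
  have hexp : Real.exp (-√(Real.log n) ^ 2 / 2) ^ 2 = 1 / n := by
    rw [Real.sq_sqrt (Real.log_nonneg (by linarith)), ← Real.exp_nat_mul, one_div,
      ← Real.exp_log hn0, ← Real.exp_neg, Real.exp_log hn0]
    congr 1
    push_cast
    ring
  -- The tail contributes `2` and rounding `q` up contributes `1/2`: this is the constant `5/2`.
  calc _ ≤ 2 * (√((j / 2 + L) / (2 * n)) ^ 2 + Real.exp (-√(Real.log n) ^ 2 / 2) ^ 2) :=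
        add_sq_le
    _ = (j / 2 + L + 2) / n := by
        rw [hexp, Real.sq_sqrt (by positivity)]
        field_simp
    _ ≤ (q + 4 * L + 5 / 2) / n := by gcongr ?_ / _; linarith
    _ ≤ (q + 4 * L + 5 / 2) / (n - 1) := by gcongr; linarith

/-- The deterministic half of the theorem: once all `n` prior moments are small, the sample plays no
further random role. -/
theorem expectedLoss_le_of_small_moments {X Y : Type*} [MeasurableSpace X] [MeasurableSpace Y]
    {D : Measure (X × Y)} [IsProbabilityMeasure D] {n k : ℕ} {δ : ℝ} {l : Y → Y → ℝ}
    {f : Weight k → X → Y} {σ η : ℝ} (hn : 2 ≤ n) (hk : 1 ≤ k) (hδ : 0 < δ) (hδ1 : δ < 1)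
    (hl : ∀ y y' : Y, 0 ≤ l y y' ∧ l y y' ≤ 1)
    (hm : Measurable fun p : Weight k × X × Y => l p.2.2 (f p.1 p.2.1)) (hσ : 0 < σ) (hη : 0 < η)
    {S : Fin n → X × Y}
    (hS : ∀ j < n, ∫⁻ x, ENNReal.ofReal (Real.exp (√(8 * n * ((j : ℝ) / 2 + Real.log (n / δ))) *
        (expectedLoss l f D x - trainLoss l f S x)))
          ∂gaussianNoise k (σ * Real.exp ((j : ℝ) / (2 * k))) <
      ENNReal.ofReal (n / δ *
        Real.exp (√(8 * n * ((j : ℝ) / 2 + Real.log (n / δ))) ^ 2 / (8 * n))))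
    {w : Weight k} {T : Weight k ≃L[ℝ] Weight k}
    (hT : ‖(T.symm : Weight k →L[ℝ] Weight k)‖ ≤ 1 / η)
    (hw : expectedLoss l f D w ≤ ∫ ε, expectedLoss l f D (w + ε) ∂gaussianNoise k σ) :
    expectedLoss l f D w ≤ worstTrainLoss l f S T (radius n k σ η) w +
      complexityTerm (5 / 2) n k δ (‖w‖ ^ 2 / (η ^ 2 * radius n k σ η ^ 2)) := by
  have hn2 : (2 : ℝ) ≤ n := by exact_mod_cast hn
  have hn1 : (0 : ℝ) < n - 1 := by linarith
  have hL := log_natCast_div_pos hn hδ hδ1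
  have hworst := worstTrainLoss_nonneg (f := f) hl S T (radius n k σ η) w
  rw [complexityTerm_eq _ hk δ hσ hη w]
  set q : ℝ := k * Real.log (1 + ‖w‖ ^ 2 / (k * σ ^ 2)) with hq
  have hq0 : 0 ≤ q :=
    mul_nonneg k.cast_nonneg (Real.log_nonneg (le_add_of_nonneg_right (by positivity)))
  -- Either the right-hand side is at least `1`, or `⌈q⌉ ≤ n - 1` is an index of the grid.
  rcases le_or_gt ((n : ℝ) - 1) q with hlarge | hsmall
  · have h1 : 1 ≤ √((q + 4 * Real.log (n / δ) + 5 / 2) / ((n : ℝ) - 1)) := by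
      rw [Real.one_le_sqrt, one_le_div hn1]
      linarith
    linarith [(expectedLoss_mem_Icc D hl hm w).2]
  · have hjn : ⌈q⌉₊ < n := by
      have : ⌈q⌉₊ ≤ n - 1 := Nat.ceil_le.2 (by rw [Nat.cast_sub (by omega)]; simpa using hsmall.le)
      omega
    have hpac := integral_expectedLoss_le (D := D) (by omega) hk hl hm hσ (Nat.cast_nonneg ⌈q⌉₊)
      ((one_lt_div hδ).2 (by linarith)) (Nat.le_ceil q) (hS _ hjn)
    have htail := integral_trainLoss_le_worstTrainLoss hk hl hm hσ (Real.sqrt_nonneg (Real.log n))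
      S w T (ball_subset_ellipsoid hk hη hT)
    have habs := sqrt_add_exp_le_sqrt hn hq0 (Nat.cast_nonneg ⌈q⌉₊) (Nat.ceil_lt_add_one hq0).le
      hL.le
    linarith

end ASAM

/-! ### Union bound over the priors -/

theorem theorem2 :
    -- `C` is the `O(1)` of the bound: an absolute constant
    ∃ C : ℝ, 0 ≤ C ∧
      ∀ (n k : ℕ) (δ : ℝ), 2 ≤ n → 1 ≤ k → 0 < δ → δ < 1 →
        -- `h : [0, ∞) → (0, ∞)` is strictly increasing
        StrictMonoOn (ASAM.complexityTerm C n k δ) (Set.Ici 0) ∧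
        (∀ t : ℝ, 0 ≤ t → 0 < ASAM.complexityTerm C n k δ t) ∧
        ∀ (X : Type*) (Y : Type*) [MeasurableSpace X] [MeasurableSpace Y]
          (D : MeasureTheory.Measure (X × Y)) [MeasureTheory.IsProbabilityMeasure D]
          (l : Y → Y → ℝ) (f : ASAM.Weight k → X → Y)
          (T : ASAM.Weight k → (ASAM.Weight k ≃L[ℝ] ASAM.Weight k)) (σ η : ℝ),
          (∀ y y' : Y, 0 ≤ l y y' ∧ l y y' ≤ 1) →
          Measurable (fun p : ASAM.Weight k × X × Y => l p.2.2 (f p.1 p.2.1)) →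
          0 < σ → 0 < η →
          -- the i.i.d. samples of size `n` for which the bound fails at some admissible `w`
          -- have (outer) probability at most `δ`
          MeasureTheory.Measure.pi (fun _ : Fin n => D)
            {S : Fin n → X × Y | ¬ ∀ w : ASAM.Weight k,
              ‖((T w).symm : ASAM.Weight k →L[ℝ] ASAM.Weight k)‖ ≤ 1 / η →
              ASAM.expectedLoss l f D w ≤
                ∫ ε, ASAM.expectedLoss l f D (w + ε) ∂(ASAM.gaussianNoise k σ) →
              ASAM.expectedLoss l f D w ≤
                ASAM.worstTrainLoss l f S (T w) (ASAM.radius n k σ η) w +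
                ASAM.complexityTerm C n k δ
                  (‖w‖ ^ 2 / (η ^ 2 * ASAM.radius n k σ η ^ 2))}
            ≤ ENNReal.ofReal δ := by
  refine ⟨5 / 2, by norm_num, fun n k δ hn hk hδ hδ1 =>
    ⟨ASAM.strictMonoOn_complexityTerm (by norm_num) hn hk hδ hδ1,
      fun t ht => ASAM.complexityTerm_pos (by norm_num) hn hδ hδ1 ht, ?_⟩⟩
  intro X Y _ _ D _ l f T σ η hl hm hσ hη
  have hn0 : (0 : ℝ) < n := by exact_mod_cast (by omega : 0 < n)
  set bad : ℕ → Set (Fin n → X × Y) := fun j =>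
    {S | ENNReal.ofReal (n / δ *
        Real.exp (√(8 * n * ((j : ℝ) / 2 + Real.log (n / δ))) ^ 2 / (8 * n))) ≤
      ∫⁻ x, ENNReal.ofReal (Real.exp (√(8 * n * ((j : ℝ) / 2 + Real.log (n / δ))) *
        (ASAM.expectedLoss l f D x - ASAM.trainLoss l f S x)))
          ∂ASAM.gaussianNoise k (σ * Real.exp ((j : ℝ) / (2 * k)))}
  have hbad : ∀ j, MeasureTheory.Measure.pi (fun _ : Fin n => D) (bad j) ≤
      ENNReal.ofReal (n / δ)⁻¹ := fun j =>
    ASAM.measure_lintegral_exp_gap_ge_le D (by omega) hl hm _ _ (by positivity)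
  -- Monotonicity holds for outer measure, so the failure set need not be measurable. The `n` events
  -- of mass at most `δ/n` add up to `δ`.
  refine (MeasureTheory.measure_mono (t := ⋃ j ∈ Finset.range n, bad j) ?_).trans ?_
  · intro S hS
    by_contra hnot
    simp only [Set.mem_iUnion, Finset.mem_range, not_exists] at hnot
    exact hS fun w hT hw => ASAM.expectedLoss_le_of_small_moments hn hk hδ hδ1 hl hm hσ hη
      (fun j hj => not_le.1 (hnot j hj)) hT hw
  · refine (MeasureTheory.measure_biUnion_finset_le _ _).trans
      ((Finset.sum_le_sum fun j _ => hbad j).trans_eq ?_)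
    rw [Finset.sum_const, Finset.card_range, nsmul_eq_mul, ← ENNReal.ofReal_natCast,
      ← ENNReal.ofReal_mul hn0.le]
    congr 1
    field_simp
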